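/- By a graph $\Gamma$ we mean a directed graph, possibly with loops and multiple edges, with vertex set $V_\Gamma$, edge set $E_\Gamma$, source and target maps $s,t:E_\Gamma\to V_\Gamma$ and a weight function $w:E_\Gamma\to\mathbb{Z}_{>0}$. For $x,y\in V_\Gamma$, let $d_\Gamma(x,y)\in\mathbb{Z}_{\ge 0}\cup\{\infty\}$ be the smallest total weight $\sum_j w(e_j)$ of a directed walk $e_1\cdots e_\ell$ from $x$ to $y$ (the trivial walk at $x$ has weight $0$, and $d_\Gamma(x,y)=\infty$ if there is no walk from $x$ to $y$). A periodic graph $(\Gamma,L)$ is a graph $\Gamma$ together with a free abelian group $L\simeq\mathbb{Z}^n$ of some finite rank $n\ge 1$ that acts freely on $V_\Gamma$ and on $E_\Gamma$, compatibly with $s$ and $t$ and preserving $w$, such that $V_\Gamma/L$ and $E_\Gamma/L$ are finite. Let $(\Gamma,L)$ be a periodic graph, let $x_0\in V_\Gamma$, let $L'<L$ be a subgroup, and let $V'\subset V_\Gamma$ be a finitely generated $L'$-submodule, i.e. a subset of the form $V'=L'+F=\{u+x \mid u\in L',\ x\in F\}$ for some finite set $F\subset V_\Gamma$. Then the set $\{y\in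 V' \mid d_\Gamma(x_0,y)\le i\}$ is finite for every $i\in\mathbb{Z}_{\ge 0}$, and the function \[ \mathbb{Z}_{\ge 0}\to\mathbb{Z}_{\ge 0};\quad i\mapsto \#\{y\in V' \mid d_\Gamma(x_0,y)\le i\} \] is of quasi-polynomial type: there exist integers $N\ge 1$ and $M\ge 0$ and polynomials $Q_0,\dots,Q_{N-1}\in\mathbb{C}[x]$ such that, for every integer $i>M$, the value of the function at $i$ equals $Q_j(i)$, where $j\in\{0,\dots,N-1\}$ and $i\equiv j\pmod N$. -/

import Mathlib

/-- A directed graph with positive integer edge weights, possibly with loops and multiple edges,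
with vertex set `V` and edge set `E`. -/
structure WeightedDigraph (V E : Type*) where
  /-- the source of an edge -/
  src : E → V
  /-- the target of an edge -/
  tgt : E → V
  /-- the weight of an edge -/
  weight : E → ℕ
  weight_pos : ∀ e, 0 < weight e

namespace WeightedDigraph

variable {V E : Type*}

/-- `Γ.IsWalk x p y`: the list `p` of consecutive edges is a walk from `x` to `y`.
The empty list is the trivial walk at `x`. -/
def IsWalk (Γ : WeightedDigraph V E) : V → List E → V → Prop
  | x, [], y => x = y
  | x, e :: p, y => Γ.src e = x ∧ Γ.IsWalk (Γ.tgt e) p y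

/-- The weight of a walk: the sum of the weights of its edges. -/
def walkWeight (Γ : WeightedDigraph V E) (p : List E) : ℕ := (p.map Γ.weight).sum

/-- The smallest weight of a walk from `x` to `y`; it is `⊤` if there is no such walk. -/
noncomputable def dist (Γ : WeightedDigraph V E) (x y : V) : ℕ∞ :=
  ⨅ (p : List E) (_ : Γ.IsWalk x p y), (Γ.walkWeight p : ℕ∞)

/-- `(Γ, L)` is an `n`-dimensional periodic graph, for given actions of `L` on the vertices and
on the edges. -/
structure IsPeriodic (Γ : WeightedDigraph V E) (L : Type*) [AddCommGroup L]
    [AddAction L V] [AddAction L E] (n : ℕ) : Prop where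
  dim_pos : 0 < n
  lattice : Nonempty (L ≃+ (Fin n → ℤ))
  free_vertices : ∀ (u : L) (x : V), u +ᵥ x = x → u = 0
  free_edges : ∀ (u : L) (e : E), u +ᵥ e = e → u = 0
  finite_vertices : Finite (AddAction.orbitRel.Quotient L V)
  finite_edges : Finite (AddAction.orbitRel.Quotient L E)
  src_vadd : ∀ (u : L) (e : E), Γ.src (u +ᵥ e) = u +ᵥ Γ.src e
  tgt_vadd : ∀ (u : L) (e : E), Γ.tgt (u +ᵥ e) = u +ᵥ Γ.tgt e
  weight_vadd : ∀ (u : L) (e : E), Γ.weight (u +ᵥ e) = Γ.weight e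

end WeightedDigraph

/-- A function `f : ℤ → ℂ` is a quasi-polynomial if for some `N > 0` it agrees with a polynomial
on each residue class modulo `N`. -/
def IsQuasiPolynomial (f : ℤ → ℂ) : Prop :=
  ∃ N : ℕ, 0 < N ∧ ∃ Q : Fin N → Polynomial ℂ,
    ∀ (m : ℤ) (i : Fin N), m ≡ (i : ℤ) [ZMOD N] → f m = (Q i).eval (m : ℂ)

/-- A function on the non-negative integers is of quasi-polynomial type if it agrees with a
quasi-polynomial at all sufficiently large integers. -/
def IsOfQuasiPolynomialType (g : ℕ → ℂ) : Prop :=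
  ∃ (M : ℕ) (f : ℤ → ℂ), IsQuasiPolynomial f ∧ ∀ m : ℕ, M < m → g m = f m

/-! Choosing an origin in each of the finitely many vertex orbits identifies every orbit with `L`. A
walk then becomes a path in the finite quotient graph whose edges carry labels (weight, translation)
in `ℕ × L`. Kleene's induction on the permitted intermediate vertices shows that the label sums of
such paths form a semilinear set (`LabelPath.isSemilinearSet`). Adding multiples of `(1, 0)` turns
"a walk of weight `i`" into "distance at most `i`", so the pairs `(i, u)` to be counted form a
semilinear set. Membership in `V'` is semilinear too, being a finite union of cosets of `L'`, and
semilinear sets are closed under intersection.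

It remains to count a semilinear set with finite fibres over its weight
(`IsSemilinearSet.hasQuasiPolyCount`). Finite unions of translates of one finitely generated monoid
are closed under intersection, so inclusion-exclusion reduces to one such union. Lexicographically
least representatives reduce this to complements of upper sets in `ℕ ^ k`, and Dickson's lemma
reduces those to orthants. An orthant is counted one coordinate at a time through a difference
equation, solved with Bernoulli polynomials. -/

/-! ### Eventually quasi-polynomial functions and difference equations -/

section

open Polynomial

/-- `g` eventually agrees with a quasi-polynomial, given by a periodic family of polynomials. -/
def EventuallyQuasiPoly (g : ℕ → ℂ) : Prop :=
  ∃ (N M : ℕ) (Q : ℕ → ℂ[X]), 0 < N ∧ Function.Periodic Q N ∧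
    ∀ m, M ≤ m → g m = (Q m).eval (m : ℂ)

namespace EventuallyQuasiPoly

variable {g h : ℕ → ℂ}

theorem isOfQuasiPolynomialType (hg : EventuallyQuasiPoly g) : IsOfQuasiPolynomialType g := by
  obtain ⟨N, M, Q, hN, hQ, H⟩ := hg
  have hN' : (0 : ℤ) < N := by exact_mod_cast hN
  refine ⟨M, fun m => (Q (m % N).toNat).eval (m : ℂ), ⟨N, hN, fun i => Q i, ?_⟩, ?_⟩
  · intro m i hmi
    have : m % N = (i : ℤ) := by
      rw [hmi.eq, Int.emod_eq_of_lt (by positivity) (by exact_mod_cast i.2)]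
    simp [this]
  · intro m hm
    have h1 : ((m : ℤ) % (N : ℤ)).toNat = m % N := by
      rw [← Int.natCast_mod, Int.toNat_natCast]
    simp only [h1, hQ.map_mod_nat, H m hm.le, Int.cast_natCast]

theorem congr (hg : EventuallyQuasiPoly g) (M : ℕ) (H : ∀ m, M ≤ m → h m = g m) :
    EventuallyQuasiPoly h := by
  obtain ⟨N, M', Q, hN, hQ, H'⟩ := hg
  refine ⟨N, max M M', Q, hN, hQ, fun m hm => ?_⟩
  rw [H m (le_trans (le_max_left _ _) hm), H' m (le_trans (le_max_right _ _) hm)]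

theorem const (c : ℂ) : EventuallyQuasiPoly fun _ => c :=
  ⟨1, 0, fun _ => C c, one_pos, fun _ => rfl, by simp⟩

theorem add (hg : EventuallyQuasiPoly g) (hh : EventuallyQuasiPoly h) :
    EventuallyQuasiPoly fun m => g m + h m := by
  obtain ⟨N, M, Q, hN, hQ, H⟩ := hg
  obtain ⟨N', M', Q', hN', hQ', H'⟩ := hh
  refine ⟨N * N', max M M', fun m => Q m + Q' m, Nat.mul_pos hN hN', ?_, fun m hm => ?_⟩
  · intro m
    have h1 := hQ.nat_mul N' m
    have h2 := hQ'.nat_mul N m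
    simp only [Nat.cast_id] at h1 h2
    simp only [h2]
    rw [mul_comm N N', h1]
  · beta_reduce
    rw [H m (le_trans (le_max_left _ _) hm), H' m (le_trans (le_max_right _ _) hm), eval_add]

theorem neg (hg : EventuallyQuasiPoly g) : EventuallyQuasiPoly fun m => - g m := by
  obtain ⟨N, M, Q, hN, hQ, H⟩ := hg
  refine ⟨N, M, fun m => - Q m, hN, fun m => by simp only [hQ m], fun m hm => ?_⟩
  beta_reduce
  rw [H m hm, eval_neg]

theorem sub (hg : EventuallyQuasiPoly g) (hh : EventuallyQuasiPoly h) :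
    EventuallyQuasiPoly fun m => g m - h m := by
  simpa only [sub_eq_add_neg] using hg.add hh.neg

theorem shift (hg : EventuallyQuasiPoly g) (a : ℕ) : EventuallyQuasiPoly fun m => g (m + a) := by
  obtain ⟨N, M, Q, hN, hQ, H⟩ := hg
  refine ⟨N, M, fun m => (Q (m + a)).comp (X + C (a : ℂ)), hN, fun m => ?_, fun m hm => ?_⟩
  · beta_reduce
    rw [add_right_comm, hQ]
  · beta_reduce
    rw [H (m + a) (by omega)]
    simp

theorem of_shift {a : ℕ} (hg : EventuallyQuasiPoly fun m => g (m + a)) :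
    EventuallyQuasiPoly g := by
  obtain ⟨N, M, Q, hN, hQ, H⟩ := hg
  -- The index is congruent to `m - a` modulo `N` and avoids truncated subtraction.
  refine ⟨N, M + a, fun m => (Q (m + (N - 1) * a)).comp (X - C (a : ℂ)), hN, fun m => ?_,
    fun m hm => ?_⟩
  · beta_reduce
    rw [add_right_comm, hQ]
  · obtain ⟨k, rfl⟩ : ∃ k, m = k + a := ⟨m - a, by omega⟩
    have h1 : k + a + (N - 1) * a = k + a * N := by
      obtain ⟨N, rfl⟩ : ∃ N', N = N' + 1 := ⟨N - 1, by omega⟩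
      simp only [Nat.add_sub_cancel]
      ring
    have h2 := hQ.nat_mul a k
    simp only [Nat.cast_id] at h2
    have h3 := H k (by omega)
    beta_reduce at h3 ⊢
    rw [h3, h1, h2]
    simp

/-- Every polynomial is a difference `S (x + p) - S x` with a given nonzero step `p`. -/
theorem exists_comp_add_sub_eq (p : ℂ) (hp : p ≠ 0) (R : ℂ[X]) :
    ∃ S : ℂ[X], S.comp (X + C p) - S = R := by
  induction R using Polynomial.induction_on' with
  | add R R' h h' =>
    obtain ⟨S, hS⟩ := h
    obtain ⟨S', hS'⟩ := h'
    exact ⟨S + S', by rw [add_comp, ← hS, ← hS']; ring⟩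
  | monomial n a =>
    let B : ℂ[X] := (Polynomial.bernoulli (n + 1)).map (algebraMap ℚ ℂ)
    have hB : B.comp (1 + X) = B + (n + 1 : ℕ) • X ^ n := by
      have := congrArg (Polynomial.map (algebraMap ℚ ℂ)) (bernoulli_comp_one_add_X (n + 1))
      simpa [Polynomial.map_comp, B] using this
    have hn : ((n : ℂ) + 1) ≠ 0 := by exact_mod_cast Nat.succ_ne_zero n
    -- Replacing `x` by `x + p` increases `B (x / p)` by `(n + 1) * (x / p) ^ n`; the constant
    -- rescales this to `a * x ^ n`.
    refine ⟨C (a * p ^ n / (n + 1)) * B.comp (C p⁻¹ * X), ?_⟩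
    have h1 : (B.comp (C p⁻¹ * X)).comp (X + C p) = (B.comp (1 + X)).comp (C p⁻¹ * X) := by
      rw [comp_assoc, comp_assoc]
      congr 1
      simp only [mul_comp, C_comp, X_comp, add_comp, one_comp, mul_add]
      rw [← C_mul, inv_mul_cancel₀ hp, C_1, add_comm]
    rw [mul_comp, C_comp, h1, hB, ← mul_sub]
    simp only [add_comp, pow_comp, X_comp, add_sub_cancel_left, mul_pow, nsmul_eq_mul,
      ← C_pow, mul_comp, natCast_comp]
    rw [← C_eq_natCast, ← mul_assoc, ← mul_assoc, ← C_mul, ← C_mul, ← C_mul_X_pow_eq_monomial]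
    congr 2
    push_cast
    rw [inv_pow]
    field_simp

/-- A solution of the difference equation `g (m + a) = g m + h m` with eventually
quasi-polynomial right-hand side `h` is eventually quasi-polynomial. -/
theorem of_difference {a : ℕ} (ha : 0 < a) (hh : EventuallyQuasiPoly h)
    (H : ∀ m, g (m + a) = g m + h m) : EventuallyQuasiPoly g := by
  have hiter : ∀ n m, g (m + n * a) = g m + ∑ l ∈ Finset.range n, h (m + l * a) := by
    intro n m
    induction n with
    | zero => simp
    | succ n ih =>
      rw [Finset.sum_range_succ, ← add_assoc, ← ih, ← H]
      congr 1
      ring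
  obtain ⟨N, M, Q, hN, hQ, HQ⟩ := hh
  -- `P` is a multiple of both the step `a` and the period `N`, so the increment of `g` over `P` is
  -- one polynomial on each residue class.
  let P := N * a
  have hP : 0 < P := Nat.mul_pos hN ha
  let R : ℕ → ℂ[X] := fun m => ∑ l ∈ Finset.range N, (Q (m + l * a)).comp (X + C ((l * a : ℕ) : ℂ))
  have hR : Function.Periodic R P := by
    intro m
    refine Finset.sum_congr rfl fun l _ => ?_
    have h2 := hQ.nat_mul a (m + l * a)
    simp only [Nat.cast_id] at h2
    rw [← h2]
    congr 2
    simp only [P]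
    ring
  have hgR : ∀ m, M ≤ m → g (m + P) = g m + (R m).eval (m : ℂ) := by
    intro m hm
    rw [hiter N m]
    congr 1
    simp only [R, eval_finsetSum]
    refine Finset.sum_congr rfl fun l _ => ?_
    rw [HQ _ (by omega)]
    simp
  choose D hD using exists_comp_add_sub_eq (P : ℂ) (by exact_mod_cast hP.ne')
  -- Subtracting a particular solution on each class leaves a function that is `P`-periodic from `M`
  -- on.
  let u : ℕ → ℂ := fun m => g m - (D (R m)).eval (m : ℂ)
  have hu : ∀ m, M ≤ m → u (m + P) = u m := by
    intro m hm
    have h1 := congrArg (eval (m : ℂ)) (hD (R m))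
    simp only [eval_sub, eval_comp, eval_add, eval_X, eval_C] at h1
    simp only [u, hgR m hm, hR m, ← h1]
    push_cast
    ring
  have hu' : ∀ k r, u (r + (M + k) * P) = u (r + M * P) := by
    intro k r
    induction k with
    | zero => rfl
    | succ k ih =>
      rw [← ih, ← hu (r + (M + k) * P)]
      · congr 1
        ring
      · nlinarith
  refine ⟨P, M * P, fun m => D (R m) + C (u (m % P + M * P)), hP, fun m => ?_, fun m hm => ?_⟩
  · simp [hR m]
  · obtain ⟨k, hk⟩ : ∃ k, m / P = M + k :=
      Nat.exists_eq_add_of_le ((Nat.le_div_iff_mul_le hP).2 hm)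
    have h1 := hu' k (m % P)
    rw [← hk, mul_comm (m / P), Nat.mod_add_div] at h1
    rw [eval_add, eval_C, ← h1]
    simp [u]

end EventuallyQuasiPoly

end

/-! ### Counting by weight -/

open Set
open scoped Pointwise

/-- The fibres in `s` of the weight function `w` are finite, and their cardinality is an eventually
quasi-polynomial function of the weight. -/
structure HasQuasiPolyCount {X : Type*} (w : X → ℕ) (s : Set X) : Prop where
  finite : ∀ i, {x ∈ s | w x = i}.Finite
  count : EventuallyQuasiPoly fun i => (({x ∈ s | w x = i}.ncard : ℕ) : ℂ)

namespace HasQuasiPolyCount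

variable {X Y : Type*} {w : X → ℕ} {s t : Set X}

theorem empty : HasQuasiPolyCount w ∅ :=
  ⟨by simp, by simpa using EventuallyQuasiPoly.const 0⟩

theorem union (hs : HasQuasiPolyCount w s) (ht : HasQuasiPolyCount w t)
    (hst : HasQuasiPolyCount w (s ∩ t)) : HasQuasiPolyCount w (s ∪ t) := by
  have h1 : ∀ i, {x ∈ s ∪ t | w x = i} = {x ∈ s | w x = i} ∪ {x ∈ t | w x = i} := by
    intro i
    ext x
    simp only [mem_union, mem_ofPred_eq]
    tauto
  have h2 : ∀ i, {x ∈ s ∩ t | w x = i} = {x ∈ s | w x = i} ∩ {x ∈ t | w x = i} := by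
    intro i
    ext x
    simp only [mem_inter_iff, mem_ofPred_eq]
    tauto
  refine ⟨fun i => ?_, ((hs.count.add ht.count).sub hst.count).congr 0 fun i _ => ?_⟩
  · rw [h1]
    exact (hs.finite i).union (ht.finite i)
  · have h3 := ncard_union_add_ncard_inter {x ∈ s | w x = i} {x ∈ t | w x = i}
      (hs.finite i) (ht.finite i)
    rw [← h1, ← h2] at h3
    rw [eq_sub_iff_add_eq]
    exact_mod_cast h3

theorem union_disjoint (hs : HasQuasiPolyCount w s) (ht : HasQuasiPolyCount w t)
    (hst : Disjoint s t) : HasQuasiPolyCount w (s ∪ t) :=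
  hs.union ht (hst.inter_eq ▸ empty)

theorem sdiff (hs : HasQuasiPolyCount w s) (ht : HasQuasiPolyCount w t) (hst : t ⊆ s) :
    HasQuasiPolyCount w (s \ t) := by
  refine ⟨fun i => (hs.finite i).subset fun x hx => ⟨hx.1.1, hx.2⟩,
    (hs.count.sub ht.count).congr 0 fun i _ => ?_⟩
  have h1 : {x ∈ s \ t | w x = i} = {x ∈ s | w x = i} \ {x ∈ t | w x = i} := by
    ext x
    simp only [mem_sdiff, mem_ofPred_eq]
    tauto
  have h2 : {x ∈ t | w x = i} ⊆ {x ∈ s | w x = i} := fun x hx => ⟨hst hx.1, hx.2⟩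
  have h3 := ncard_sdiff_add_ncard_of_subset h2 (hs.finite i)
  rw [← h1] at h3
  rw [eq_sub_iff_add_eq]
  exact_mod_cast h3

theorem biUnion_disjoint {ι : Type*} (I : Finset ι) (f : ι → Set X)
    (hf : ∀ i ∈ I, HasQuasiPolyCount w (f i)) (hd : ∀ i j, i ≠ j → Disjoint (f i) (f j)) :
    HasQuasiPolyCount w (⋃ i ∈ I, f i) := by
  classical
  induction I using Finset.induction_on with
  | empty => simpa using empty
  | insert i I hi ih =>
    rw [Finset.set_biUnion_insert]
    refine (hf i (Finset.mem_insert_self i I)).union_disjoint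
      (ih fun j hj => hf j (Finset.mem_insert_of_mem hj)) ?_
    simp only [disjoint_iUnion_right]
    intro j hj
    exact hd i j fun h => hi (h ▸ hj)

/-- Inclusion-exclusion for finite unions of members of a family closed under intersection. -/
theorem biUnion_of_inter {ι : Type*} {p : Set X → Prop} (hp : ∀ s, p s → HasQuasiPolyCount w s)
    (hinter : ∀ s t, p s → p t → p (s ∩ t)) (I : Finset ι) (f : ι → Set X)
    (hf : ∀ i ∈ I, p (f i)) : HasQuasiPolyCount w (⋃ i ∈ I, f i) := by
  classical
  induction I using Finset.induction_on generalizing f with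
  | empty => simpa using empty
  | insert i I hi ih =>
    have h1 := hf i (Finset.mem_insert_self i I)
    have h2 : ∀ j ∈ I, p (f j) := fun j hj => hf j (Finset.mem_insert_of_mem hj)
    rw [Finset.set_biUnion_insert]
    refine (hp _ h1).union (ih f h2) ?_
    -- The intersection is a union over the smaller index set `I` of members of the family, so the
    -- induction hypothesis applies to it as well.
    rw [inter_iUnion₂]
    exact ih _ fun j hj => hinter _ _ h1 (h2 j hj)

theorem fiber_image_eq {v : Y → ℕ} {f : X → Y} {a : ℕ} (ha : ∀ x ∈ s, v (f x) = w x + a) (i : ℕ) :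
    {y ∈ f '' s | v y = i + a} = f '' {x ∈ s | w x = i} := by
  ext y
  constructor
  · rintro ⟨⟨x, hx, rfl⟩, h⟩
    exact ⟨x, ⟨hx, by have := ha x hx; omega⟩, rfl⟩
  · rintro ⟨x, ⟨hx, rfl⟩, rfl⟩
    exact ⟨⟨x, hx, rfl⟩, ha x hx⟩

theorem fiber_image_eq_empty {v : Y → ℕ} {f : X → Y} {a : ℕ} (ha : ∀ x ∈ s, v (f x) = w x + a)
    {i : ℕ} (hi : i < a) : {y ∈ f '' s | v y = i} = ∅ := by
  ext y
  simp only [mem_ofPred_eq, mem_empty_iff_false, iff_false]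
  rintro ⟨⟨x, hx, rfl⟩, h⟩
  have := ha x hx
  omega

theorem image {v : Y → ℕ} {f : X → Y} {a : ℕ} (hs : HasQuasiPolyCount w s) (hf : InjOn f s)
    (ha : ∀ x ∈ s, v (f x) = w x + a) : HasQuasiPolyCount v (f '' s) := by
  refine ⟨fun i => ?_, EventuallyQuasiPoly.of_shift (a := a) (hs.count.congr 0 fun i _ => ?_)⟩
  · rcases lt_or_ge i a with h | h
    · rw [fiber_image_eq_empty ha h]
      exact finite_empty
    · obtain ⟨k, rfl⟩ : ∃ k, i = k + a := ⟨i - a, by omega⟩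
      rw [fiber_image_eq ha]
      exact (hs.finite k).image f
  · rw [fiber_image_eq ha, (hf.mono fun x hx => hx.1).ncard_image]

/-- A set consisting of `t` and a copy of itself with weights raised by `a > 0`. -/
theorem of_eq_union_image {f : X → X} {a : ℕ} (h0 : 0 < a) (ht : HasQuasiPolyCount w t)
    (hf : InjOn f s) (ha : ∀ x ∈ s, w (f x) = w x + a) (hst : s = t ∪ f '' s)
    (hd : Disjoint t (f '' s)) : HasQuasiPolyCount w s := by
  have h1 : ∀ i, {x ∈ s | w x = i} = {x ∈ t | w x = i} ∪ {x ∈ f '' s | w x = i} := by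
    intro i
    ext x
    conv_lhs => rw [hst]
    simp only [mem_union, mem_ofPred_eq]
    tauto
  have hfin : ∀ i, {x ∈ s | w x = i}.Finite := by
    intro i
    induction i using Nat.strong_induction_on with
    | _ i ih =>
      rw [h1]
      refine (ht.finite i).union ?_
      rcases lt_or_ge i a with h | h
      · rw [fiber_image_eq_empty ha h]
        exact finite_empty
      · obtain ⟨k, rfl⟩ : ∃ k, i = k + a := ⟨i - a, by omega⟩
        rw [fiber_image_eq ha]
        exact (ih k (by omega)).image f
  -- If `g` and `h` count `s` and `t`, the decomposition reads `g (i + a) = g i + h (i + a)`.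
  refine ⟨hfin, EventuallyQuasiPoly.of_difference h0 (ht.count.shift a) fun i => ?_⟩
  have h2 : {x ∈ f '' s | w x = i + a}.Finite := by
    rw [fiber_image_eq ha]
    exact (hfin i).image f
  have h3 : Disjoint {x ∈ t | w x = i + a} {x ∈ f '' s | w x = i + a} :=
    hd.mono (fun x hx => hx.1) (fun x hx => hx.1)
  rw [h1, ncard_union_eq h3 (ht.finite _) h2, fiber_image_eq ha,
    (hf.mono fun x hx => hx.1).ncard_image, add_comm]
  push_cast
  rfl

theorem singleton (x : X) : HasQuasiPolyCount w {x} := by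
  refine ⟨fun i => (finite_singleton x).subset fun y hy => hy.1,
    (EventuallyQuasiPoly.const 0).congr (w x + 1) fun i hi => ?_⟩
  have : {y ∈ ({x} : Set X) | w y = i} = ∅ := by
    ext y
    simp only [mem_singleton_iff, mem_ofPred_eq, mem_empty_iff_false, iff_false]
    rintro ⟨rfl, h⟩
    omega
  rw [this]
  simp

end HasQuasiPolyCount

/-! ### Orthants and upper sets in `ℕ ^ ι` -/

section Orthant

variable {ι : Type*} [Finite ι]

/-- The orthant `ℕ ^ ι` graded by positive weights. -/
theorem hasQuasiPolyCount_univ (w : (ι → ℕ) →+ ℕ)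
    (hw : ∀ c, w c = 0 → c = 0) : HasQuasiPolyCount w univ := by
  classical
  have := Fintype.ofFinite ι
  suffices h : ∀ T : Finset ι, HasQuasiPolyCount w {c | ∀ i ∉ T, c i = 0} by
    simpa using h Finset.univ
  intro T
  induction T using Finset.induction_on with
  | empty =>
    convert HasQuasiPolyCount.singleton (0 : ι → ℕ)
    ext c
    simp [funext_iff]
  | insert j T hj ih =>
    -- The face spanned by `insert j T` splits into the vectors with `c j = 0` and its own translate
    -- by the `j`-th basis vector.
    refine ih.of_eq_union_image (f := fun c => c + Pi.single j 1) (a := w (Pi.single j 1)) ?_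
      (add_left_injective _).injOn (fun c _ => map_add w c _) ?_ ?_
    · refine Nat.pos_of_ne_zero fun h => ?_
      simpa using congrFun (hw _ h) j
    · ext c
      simp only [Finset.mem_insert, not_or, mem_ofPred_eq, mem_union, mem_image]
      constructor
      · intro h
        by_cases hc : c j = 0
        · left
          intro i hi
          by_cases hij : i = j
          · exact hij ▸ hc
          · exact h i ⟨hij, hi⟩
        · right
          refine ⟨c - Pi.single j 1, fun i hi => ?_, ?_⟩
          · simp [h i hi]
          · ext i
            by_cases hij : i = j
            · subst hij
              simp
              omega
            · simp [hij]
      · rintro (h | ⟨d, hd, rfl⟩) i hi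
        · exact h i hi.2
        · simp [hd i hi, hi.1]
    · rw [Set.disjoint_left]
      rintro _ h ⟨d, -, rfl⟩
      simpa using h j hj

/-- By Dickson's lemma an upper set is a finite union of sets `Ici a`. Each is a translate of the
full orthant, and they are closed under intersection. -/
theorem IsUpperSet.hasQuasiPolyCount {U : Set (ι → ℕ)} (hU : IsUpperSet U) (w : (ι → ℕ) →+ ℕ)
    (hw : ∀ c, w c = 0 → c = 0) : HasQuasiPolyCount w U := by
  have hfin : {c | Minimal (· ∈ U) c}.Finite :=
    WellQuasiOrderedLE.finite_of_isAntichain (setOfPred_minimal_antichain _)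
  have hU' : U = ⋃ a ∈ hfin.toFinset, Ici a := by
    ext c
    simp only [Finite.mem_toFinset, mem_ofPred_eq, mem_iUnion, mem_Ici, exists_prop]
    constructor
    · intro hc
      obtain ⟨m, hm, hm'⟩ := exists_minimal_le_of_wellFoundedLT (· ∈ U) c hc
      exact ⟨m, hm', hm⟩
    · rintro ⟨m, hm, h⟩
      exact hU h hm.1
  rw [hU']
  refine HasQuasiPolyCount.biUnion_of_inter (p := fun s => ∃ a, s = Ici a) ?_ ?_ _ _
    fun a _ => ⟨a, rfl⟩
  · rintro _ ⟨a, rfl⟩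
    have h1 : Ici a = (fun c => c + a) '' univ := by
      ext c
      simp only [mem_Ici, image_univ, mem_range]
      constructor
      · intro h
        exact ⟨c - a, tsub_add_cancel_of_le h⟩
      · rintro ⟨d, rfl⟩
        exact le_add_self
    rw [h1]
    exact (hasQuasiPolyCount_univ w hw).image (add_left_injective _).injOn
      fun c _ => map_add w c a
  · rintro _ _ ⟨a, rfl⟩ ⟨b, rfl⟩
    exact ⟨a ⊔ b, Ici_inter_Ici⟩

end Orthant

/-! ### Finitely generated monoids and semilinear sets -/

section FinitelyGenerated

variable {G : Type*} [AddCommMonoid G]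

/-- Translates are added one at a time. The new elements `f + φ c` are counted by the
lexicographically least `c` in each fibre of `φ`; the remaining vectors form an upper set because
the lexicographic order is translation invariant. -/
theorem hasQuasiPolyCount_finset_add_mrange [IsCancelAdd G] (w : G →+ ℕ) {k : ℕ}
    (φ : (Fin k → ℕ) →+ G) (hφ : ∀ c, w (φ c) = 0 → c = 0) (F : Finset G) :
    HasQuasiPolyCount w ((F : Set G) + (AddMonoidHom.mrange φ : Set G)) := by
  classical
  induction F using Finset.induction_on with
  | empty => simpa using HasQuasiPolyCount.empty
  | insert f F _ ih =>
    set A := (F : Set G) + (AddMonoidHom.mrange φ : Set G) with hA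
    have hAadd : ∀ x ∈ A, ∀ c, x + φ c ∈ A := by
      rintro _ ⟨y, hy, _, ⟨d, rfl⟩, rfl⟩ c
      exact ⟨y, hy, φ (d + c), ⟨d + c, rfl⟩, by simp [add_assoc]⟩
    -- The vectors to discard: those giving an element already counted in `A`, or not least in their
    -- fibre.
    let U : Set (Fin k → ℕ) := {c | f + φ c ∈ A ∨ ∃ d, toLex d < toLex c ∧ φ d = φ c}
    have hU : IsUpperSet U := by
      intro c c' hcc' hc
      obtain ⟨e, rfl⟩ := exists_add_of_le hcc'
      rcases hc with hc | ⟨d, hd, hdc⟩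
      · left
        rw [map_add, ← add_assoc]
        exact hAadd _ hc _
      · right
        exact ⟨d + e, by simpa using add_lt_add_left hd (toLex e), by simp [hdc]⟩
    have hcount : HasQuasiPolyCount (w.comp φ) (univ \ U) :=
      (hasQuasiPolyCount_univ _ hφ).sdiff (hU.hasQuasiPolyCount _ hφ) (subset_univ _)
    have hinj : InjOn (fun c => f + φ c) (univ \ U) := by
      rintro c ⟨-, hc⟩ d ⟨-, hd⟩ h
      have h' : φ c = φ d := add_left_cancel h
      rcases lt_trichotomy (toLex c) (toLex d) with h1 | h1 | h1
      · exact absurd (Or.inr ⟨c, h1, h'⟩) hd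
      · exact toLex.injective h1
      · exact absurd (Or.inr ⟨d, h1, h'.symm⟩) hc
    have himage := hcount.image (v := w) (a := w f) hinj fun c _ => by simp [add_comm]
    have hd : Disjoint A ((fun c => f + φ c) '' (univ \ U)) := by
      rw [Set.disjoint_left]
      rintro _ h ⟨c, ⟨-, hc⟩, rfl⟩
      exact hc (Or.inl h)
    convert ih.union_disjoint himage hd
    rw [Finset.coe_insert, insert_eq, union_add, ← hA, union_comm]
    ext x
    simp only [mem_union, singleton_add, mem_image]
    constructor
    · rintro (h | ⟨_, ⟨c, rfl⟩, rfl⟩)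
      · exact Or.inl h
      · by_cases h : f + φ c ∈ A
        · exact Or.inl h
        · right
          obtain ⟨d, hd, hmin⟩ := WellFounded.has_min (wellFounded_lt (α := Lex (Fin k → ℕ)))
            {d | φ (ofLex d) = φ c} ⟨toLex c, rfl⟩
          have hdc : φ (ofLex d) = φ c := hd
          refine ⟨ofLex d, ⟨mem_univ _, ?_⟩, by rw [hdc]⟩
          rintro (h' | ⟨e, he, hed⟩)
          · exact h (by rwa [hdc] at h')
          · exact hmin (toLex e) (hed.trans hd) he
    · rintro (h | ⟨c, -, rfl⟩)
      · exact Or.inl h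
      · exact Or.inr ⟨φ c, ⟨c, rfl⟩, rfl⟩

/-- A finitely generated monoid without nonzero elements of weight zero is the image of some
`ℕ ^ k` under a homomorphism for which all nonzero vectors have positive weight. -/
theorem AddSubmonoid.FG.exists_fin_addMonoidHom_of_weight {M : AddSubmonoid G} (hM : M.FG)
    (w : G →+ ℕ) (hw : ∀ m ∈ M, w m = 0 → m = 0) :
    ∃ (k : ℕ) (φ : (Fin k → ℕ) →+ G), (∀ c, w (φ c) = 0 → c = 0) ∧ AddMonoidHom.mrange φ = M := by
  classical
  obtain ⟨t, rfl⟩ := hM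
  -- A zero generator would yield a nonzero vector of weight zero.
  let T := t.erase 0
  have hT : AddSubmonoid.closure (T : Set G) = AddSubmonoid.closure (t : Set G) := by
    simp [T]
  let e := T.equivFin
  let φ : (Fin T.card → ℕ) →+ G :=
    { toFun := fun c => ∑ a : T, c (e a) • (a : G)
      map_zero' := by simp
      map_add' := by simp [add_smul, Finset.sum_add_distrib] }
  refine ⟨T.card, φ, fun c hc => ?_, ?_⟩
  · funext i
    have h1 : ∑ a : T, c (e a) * w a = 0 := by
      simpa [φ, map_sum] using hc
    have h2 := (Finset.sum_eq_zero_iff.1 h1) (e.symm i) (Finset.mem_univ _)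
    rcases Nat.mul_eq_zero.1 h2 with h | h
    · simpa using h
    · have h3 := Finset.mem_erase.1 (e.symm i).2
      exact absurd (hw _ (AddSubmonoid.subset_closure h3.2) h) h3.1
  · rw [← hT]
    apply le_antisymm
    · rintro _ ⟨c, rfl⟩
      exact _root_.sum_mem fun a _ => _root_.nsmul_mem (AddSubmonoid.subset_closure a.2) _
    · rw [AddSubmonoid.closure_le]
      intro a ha
      refine ⟨Pi.single (e ⟨a, ha⟩) 1, ?_⟩
      change ∑ b : T, (Pi.single (e ⟨a, ha⟩) 1 : Fin T.card → ℕ) (e b) • (b : G) = a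
      rw [Finset.sum_eq_single ⟨a, ha⟩]
      · simp
      · intro b _ hb
        rw [Pi.single_eq_of_ne (fun h => hb (e.injective h)), zero_smul]
      · simp

/-- `s` is a finite union of translates of one finitely generated monoid that has no nonzero
elements of weight zero. -/
def IsFGTranslate (w : G →+ ℕ) (s : Set G) : Prop :=
  ∃ (F : Set G) (M : AddSubmonoid G), F.Finite ∧ M.FG ∧ (∀ m ∈ M, w m = 0 → m = 0) ∧
    s = F + (M : Set G)

variable [IsCancelAdd G] {w : G →+ ℕ}

theorem IsFGTranslate.hasQuasiPolyCount {s : Set G} (hs : IsFGTranslate w s) :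
    HasQuasiPolyCount w s := by
  obtain ⟨F, M, hF, hM, hw, rfl⟩ := hs
  obtain ⟨k, φ, hφ, rfl⟩ := hM.exists_fin_addMonoidHom_of_weight w hw
  simpa using hasQuasiPolyCount_finset_add_mrange w φ hφ hF.toFinset

/-- By cancellation, a solution of `f + φ c = f' + ψ c'` is a minimal solution plus a solution of
the homogeneous equation. Minimal solutions are finite in number by Dickson's lemma, and the
homogeneous ones form a finitely generated monoid independent of `f` and `f'`, so one monoid serves
all pairs. -/
theorem IsFGTranslate.inter {s t : Set G} (hs : IsFGTranslate w s) (ht : IsFGTranslate w t) :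
    IsFGTranslate w (s ∩ t) := by
  obtain ⟨F, M, hF, hM, hw, rfl⟩ := hs
  obtain ⟨F', M', hF', hM', -, rfl⟩ := ht
  obtain ⟨k, φ, rfl⟩ := AddSubmonoid.fg_iff_exists_fin_addMonoidHom.1 hM
  obtain ⟨l, ψ, rfl⟩ := AddSubmonoid.fg_iff_exists_fin_addMonoidHom.1 hM'
  let φ' : (Fin k → ℕ) × (Fin l → ℕ) →+ G := φ.comp (AddMonoidHom.fst _ _)
  let ψ' : (Fin k → ℕ) × (Fin l → ℕ) →+ G := ψ.comp (AddMonoidHom.snd _ _)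
  let D : G → G → Set ((Fin k → ℕ) × (Fin l → ℕ)) := fun f f' =>
    {c | Minimal (fun c => f + φ' c = f' + ψ' c) c}
  have hD : ∀ f f', (D f f').Finite := fun f f' =>
    WellQuasiOrderedLE.finite_of_isAntichain (setOfPred_minimal_antichain _)
  refine ⟨⋃ f ∈ F, ⋃ f' ∈ F', (fun c => f + φ' c) '' D f f',
    (φ'.eqLocusM ψ').map φ', ?_, (AddSubmonoid.fg_eqLocusM φ' ψ').map φ', ?_, ?_⟩
  · exact hF.biUnion fun f _ => hF'.biUnion fun f' _ => (hD f f').image _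
  · rintro _ ⟨c, -, rfl⟩ h
    exact hw _ ⟨c.1, rfl⟩ h
  · ext x
    constructor
    · rintro ⟨⟨f, hf, _, ⟨c, rfl⟩, rfl⟩, ⟨f', hf', _, ⟨c', rfl⟩, h⟩⟩
      obtain ⟨m, hm, hm'⟩ := exists_minimal_le_of_wellFoundedLT
        (fun c => f + φ' c = f' + ψ' c) (c, c') h.symm
      obtain ⟨d, hd⟩ := exists_add_of_le hm
      have hφ : φ c = φ' m + φ' d := by rw [← map_add, ← hd]; rfl
      have hψ : ψ c' = ψ' m + ψ' d := by rw [← map_add, ← hd]; rfl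
      refine ⟨f + φ' m, ?_, φ' d, ⟨d, ?_, rfl⟩, ?_⟩
      · simp only [mem_iUnion]
        exact ⟨f, hf, f', hf', m, hm', rfl⟩
      · have h1 : f' + ψ c' = f + φ c := h
        rw [hφ, hψ, ← add_assoc, ← add_assoc, ← hm'.1] at h1
        exact (add_left_cancel h1).symm
      · change f + φ' m + φ' d = f + φ c
        rw [hφ, add_assoc]
    · rintro ⟨y, hy, _, ⟨d, hd, rfl⟩, rfl⟩
      simp only [mem_iUnion] at hy
      obtain ⟨f, hf, f', hf', m, hm, rfl⟩ := hy
      have hd' : φ' d = ψ' d := hd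
      refine ⟨⟨f, hf, φ' (m + d), ⟨(m + d).1, rfl⟩, ?_⟩,
        ⟨f', hf', ψ' (m + d), ⟨(m + d).2, rfl⟩, ?_⟩⟩
      · simp [add_assoc]
      · change f' + ψ' (m + d) = f + φ' m + φ' d
        rw [map_add, ← add_assoc, ← hm.1, hd']

/-- A semilinear set with finite fibres with respect to an additive weight. -/
theorem IsSemilinearSet.hasQuasiPolyCount [IsAddTorsionFree G] {s : Set G} (hs : IsSemilinearSet s)
    (hfin : ∀ i, {x ∈ s | w x = i}.Finite) : HasQuasiPolyCount w s := by
  obtain ⟨S, hS, hlin, rfl⟩ := hs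
  have h1 : ⋃₀ S = ⋃ t ∈ hS.toFinset, t := by
    simp [sUnion_eq_biUnion]
  rw [h1]
  refine HasQuasiPolyCount.biUnion_of_inter (p := IsFGTranslate w)
    (fun _ h => h.hasQuasiPolyCount) (fun _ _ h h' => h.inter h') _ _ fun t ht => ?_
  have htS : t ∈ S := hS.mem_toFinset.1 ht
  obtain ⟨a, T, hT, rfl⟩ := hlin t htS
  refine ⟨{a}, AddSubmonoid.closure T, finite_singleton a,
    (AddSubmonoid.fg_iff _).2 ⟨T, rfl, hT⟩, fun m hm hwm => ?_, ?_⟩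
  · by_contra hne
    -- A nonzero period `m` of weight zero would, by torsion-freeness, put infinitely many points `a
    -- + n • m` in the fibre over `w a`.
    have hinj : Function.Injective fun n : ℕ => a + n • m := by
      refine Function.Injective.comp (g := (a + ·)) (add_right_injective a) ?_
      intro n n' h
      by_contra hnn
      wlog hlt : n < n' generalizing n n'
      · exact this h.symm (Ne.symm hnn) (by omega)
      obtain ⟨d, rfl⟩ := Nat.exists_eq_add_of_lt hlt
      have h2 : n • m + 0 = n • m + (d + 1) • m := by
        rw [add_zero, ← add_nsmul, ← add_assoc]
        exact h
      exact hne (nsmul_right_injective (Nat.succ_ne_zero d)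
        ((add_left_cancel h2).symm.trans (nsmul_zero _).symm))
    refine infinite_range_of_injective hinj ((hfin (w a)).subset ?_)
    rintro _ ⟨n, rfl⟩
    refine ⟨mem_sUnion.2 ⟨_, htS, ⟨n • m, nsmul_mem hm n, rfl⟩⟩, ?_⟩
    simp [hwm]
  · simp [singleton_add, ← image_vadd]

end FinitelyGenerated

/-! ### Label sums of paths in a finite graph -/

/-- `LabelPath T S a b g`: there is a nonempty path from `a` to `b`, with all intermediate vertices
in `S`, whose labels, taken from the sets `T`, add up to `g`. -/
inductive LabelPath {Q G : Type*} [AddMonoid G] (T : Q → Q → Set G) (S : Set Q) :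
    Q → Q → G → Prop
  | single {a b : Q} {g : G} : g ∈ T a b → LabelPath T S a b g
  | cons {a c b : Q} {g h : G} : g ∈ T a c → c ∈ S → LabelPath T S c b h → LabelPath T S a b (g + h)

namespace LabelPath

variable {Q G : Type*} [AddCommMonoid G] {T : Q → Q → Set G} {S S' : Set Q} {a b c : Q} {g h : G}

theorem mono (hS : S ⊆ S') (p : LabelPath T S a b g) : LabelPath T S' a b g := by
  induction p with
  | single h => exact .single h
  | cons h hc _ ih => exact .cons h (hS hc) ih

theorem trans (hc : c ∈ S) (p : LabelPath T S a c g) (p' : LabelPath T S c b h) :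
    LabelPath T S a b (g + h) := by
  induction p with
  | single h => exact .cons h hc p'
  | cons h hd _ ih =>
    rw [add_assoc]
    exact .cons h hd (ih hc p')

/-- Kleene's decomposition: a path through `k` is cut at its visits to `k` into an initial path,
loops at `k`, and a final path. Only the sum of the loops matters, hence the submonoid closure. -/
theorem insert_iff {k : Q} : LabelPath T (insert k S) a b g ↔ LabelPath T S a b g ∨
    ∃ g₁ g₂ g₃, LabelPath T S a k g₁ ∧ g₂ ∈ AddSubmonoid.closure {g | LabelPath T S k k g} ∧
      LabelPath T S k b g₃ ∧ g = g₁ + g₂ + g₃ := by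
  constructor
  · intro p
    induction p with
    | single h => exact Or.inl (.single h)
    | @cons a c b g h hg hc _ ih =>
      rcases hc with rfl | hc
      · right
        rcases ih with ih | ⟨g₁, g₂, g₃, h₁, h₂, h₃, rfl⟩
        · exact ⟨g, 0, h, .single hg, zero_mem _, ih, by simp⟩
        · exact ⟨g, g₁ + g₂, g₃, .single hg,
            add_mem (AddSubmonoid.subset_closure h₁) h₂, h₃, by simp only [add_assoc]⟩
      · rcases ih with ih | ⟨g₁, g₂, g₃, h₁, h₂, h₃, rfl⟩
        · exact Or.inl (.cons hg hc ih)
        · exact Or.inr ⟨g + g₁, g₂, g₃, .cons hg hc h₁, h₂, h₃, by simp only [add_assoc]⟩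
  · rintro (p | ⟨g₁, g₂, g₃, h₁, h₂, h₃, rfl⟩)
    · exact p.mono (subset_insert k S)
    · have hk : k ∈ insert k S := mem_insert k S
      refine trans hk ?_ (h₃.mono (subset_insert k S))
      replace h₁ := h₁.mono (subset_insert k S)
      induction h₂ using AddSubmonoid.closure_induction generalizing g₁ with
      | mem x hx => exact trans hk h₁ (hx.mono (subset_insert k S))
      | zero => simpa using h₁
      | add x y _ _ hx hy =>
        rw [← add_assoc]
        exact hy _ (hx _ h₁)

/-- The label sums of paths between two vertices of a finite labelled graph form a semilinear
set. -/
theorem isSemilinearSet [Finite Q] (hT : ∀ a b, IsSemilinearSet (T a b)) (S : Set Q) (a b : Q) :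
    IsSemilinearSet {g | LabelPath T S a b g} := by
  induction S, S.toFinite using Set.Finite.induction_on generalizing a b with
  | empty =>
    convert hT a b
    ext g
    constructor
    · rintro (h | ⟨-, h, -⟩)
      · exact h
      · exact h.elim
    · exact .single
  | @insert k S _ _ ih =>
    convert (ih a b).union (((ih a k).add (ih k k).closure).add (ih k b))
    ext g
    rw [mem_ofPred_eq, insert_iff]
    simp only [mem_union, mem_ofPred_eq, mem_add, SetLike.mem_coe]
    refine or_congr_right ?_
    constructor
    · rintro ⟨g₁, g₂, g₃, h₁, h₂, h₃, rfl⟩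
      exact ⟨g₁ + g₂, ⟨g₁, h₁, g₂, h₂, rfl⟩, g₃, h₃, rfl⟩
    · rintro ⟨_, ⟨g₁, h₁, g₂, h₂, rfl⟩, g₃, h₃, rfl⟩
      exact ⟨g₁, g₂, g₃, h₁, h₂, h₃, rfl⟩

end LabelPath

/-! ### Coordinates on the orbits of a free action -/

/-- Coordinates for a free action: every point is the translate by `trans x` of the
representative `rep (cls x)` of its orbit. -/
structure OrbitCoordinates (L V Q : Type*) [AddCommGroup L] [AddAction L V] where
  /-- the orbit of a point -/
  cls : V → Q
  /-- the translation part of a point -/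
  trans : V → L
  /-- the representative of an orbit -/
  rep : Q → V
  vadd_rep : ∀ x, trans x +ᵥ rep (cls x) = x
  cls_vadd_rep : ∀ (u : L) a, cls (u +ᵥ rep a) = a
  trans_vadd_rep : ∀ (u : L) a, trans (u +ᵥ rep a) = u

namespace OrbitCoordinates

variable {L V Q : Type*} [AddCommGroup L] [AddAction L V] (κ : OrbitCoordinates L V Q)

theorem cls_vadd (u : L) (x : V) : κ.cls (u +ᵥ x) = κ.cls x := by
  conv_lhs => rw [← κ.vadd_rep x, vadd_vadd, κ.cls_vadd_rep]

theorem trans_vadd (u : L) (x : V) : κ.trans (u +ᵥ x) = u + κ.trans x := by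
  conv_lhs => rw [← κ.vadd_rep x, vadd_vadd, κ.trans_vadd_rep]

theorem nonempty_of_free (h : ∀ (u : L) (x : V), u +ᵥ x = x → u = 0) :
    Nonempty (OrbitCoordinates L V (AddAction.orbitRel.Quotient L V)) := by
  have h1 : ∀ x : V, ∃ u : L,
      u +ᵥ (Quotient.mk (AddAction.orbitRel L V) x).out = x := by
    intro x
    exact AddAction.orbitRel_apply.1 (Setoid.symm' _ (Quotient.mk_out x))
  choose τ hτ using h1
  have h2 : ∀ (u : L) (a : AddAction.orbitRel.Quotient L V),
      Quotient.mk (AddAction.orbitRel L V) (u +ᵥ a.out) = a := by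
    intro u a
    conv_rhs => rw [← Quotient.out_eq a]
    exact Quotient.sound (AddAction.orbitRel_apply.2 ⟨u, rfl⟩)
  refine ⟨⟨Quotient.mk _, τ, Quotient.out, hτ, h2, fun u a => ?_⟩⟩
  have h3 := hτ (u +ᵥ a.out)
  rw [h2] at h3
  have h4 : (-u + τ (u +ᵥ a.out)) +ᵥ a.out = a.out := by
    rw [← vadd_vadd, h3, neg_vadd_vadd]
  have := h _ _ h4
  rwa [neg_add_eq_zero, eq_comm] at this

end OrbitCoordinates

/-! ### Walks and the quotient graph -/

namespace WeightedDigraph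

variable {V E : Type*} (Γ : WeightedDigraph V E)

theorem dist_le_iff {x y : V} {i : ℕ} :
    Γ.dist x y ≤ i ↔ ∃ p, Γ.IsWalk x p y ∧ Γ.walkWeight p ≤ i := by
  constructor
  · intro h
    -- A strict bound on the infimum produces an actual walk.
    have h1 : Γ.dist x y < (i : ℕ∞) + 1 :=
      lt_of_le_of_lt h (by exact_mod_cast Nat.lt_succ_self i)
    simp only [dist, iInf_lt_iff] at h1
    obtain ⟨p, hp, h2⟩ := h1
    exact ⟨p, hp, Nat.lt_succ_iff.1 (by exact_mod_cast h2)⟩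
  · rintro ⟨p, hp, h⟩
    exact (iInf₂_le p hp).trans (by exact_mod_cast h)

/-- Out-degrees are finite, and positivity of weights means that the first edge uses up at least one
unit of the bound `i`. -/
theorem finite_setOf_dist_le (hΓ : ∀ x, {e | Γ.src e = x}.Finite) (x : V) (i : ℕ) :
    {y | Γ.dist x y ≤ i}.Finite := by
  simp only [dist_le_iff]
  induction i using Nat.strong_induction_on generalizing x with
  | _ i ih =>
    rcases Nat.eq_zero_or_pos i with rfl | hi
    · refine (finite_singleton x).subset ?_
      rintro y ⟨p, hp, h⟩
      cases p with
      | nil => exact (show x = y from hp).symm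
      | cons e p =>
        have := Γ.weight_pos e
        simp [walkWeight] at h
        omega
    · refine ((finite_singleton x).union ((hΓ x).biUnion fun e _ =>
        ih (i - 1) (by omega) (Γ.tgt e))).subset ?_
      rintro y ⟨p, hp, h⟩
      cases p with
      | nil => exact Or.inl (show x = y from hp).symm
      | cons e p =>
        right
        have := Γ.weight_pos e
        simp only [walkWeight, List.map_cons, List.sum_cons] at h
        simp only [mem_iUnion]
        exact ⟨e, hp.1, p, hp.2, by simp only [walkWeight]; omega⟩

variable {L Q : Type*} [AddCommGroup L] [AddAction L V]

/-- The pairs (weight, translation) of the edges between two orbits of vertices. -/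
def edgeLabels (κ : OrbitCoordinates L V Q) (a b : Q) : Set (ℕ × L) :=
  (fun e => (Γ.weight e, κ.trans (Γ.tgt e) - κ.trans (Γ.src e))) ''
    {e | κ.cls (Γ.src e) = a ∧ κ.cls (Γ.tgt e) = b}

variable {Γ} (κ : OrbitCoordinates L V Q)

/-- Projection to the quotient graph: the translation differences along the walk telescope. -/
theorem IsWalk.labelPath {x y : V} {p : List E} (hp : Γ.IsWalk x p y) (hne : p ≠ []) :
    LabelPath (Γ.edgeLabels κ) univ (κ.cls x) (κ.cls y)
      (Γ.walkWeight p, κ.trans y - κ.trans x) := by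
  induction p generalizing x with
  | nil => exact absurd rfl hne
  | cons e p ih =>
    obtain ⟨rfl, hp⟩ := hp
    by_cases h : p = []
    · subst h
      obtain rfl : Γ.tgt e = y := hp
      refine .single ⟨e, ⟨rfl, rfl⟩, ?_⟩
      simp [walkWeight]
    · have h1 := LabelPath.cons (T := Γ.edgeLabels κ) (S := univ)
        ⟨e, ⟨rfl, rfl⟩, rfl⟩ (mem_univ _) (ih hp h)
      convert h1 using 1
      simp [walkWeight]

variable [AddAction L E] {n : ℕ}

/-- The label of an edge is invariant under `L`, so it factors through the finite set of edge
orbits. -/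
theorem IsPeriodic.finite_edgeLabels (hΓ : Γ.IsPeriodic L n) (a b : Q) : (Γ.edgeLabels κ a b).Finite := by
  have := hΓ.finite_edges
  let f : E → ℕ × L := fun e => (Γ.weight e, κ.trans (Γ.tgt e) - κ.trans (Γ.src e))
  have hf : ∀ e e', (AddAction.orbitRel L E) e e' → f e = f e' := by
    intro e e' h
    obtain ⟨u, rfl⟩ := AddAction.orbitRel_apply.1 h
    simp [f, hΓ.weight_vadd, hΓ.src_vadd, hΓ.tgt_vadd, κ.trans_vadd]
  refine (finite_range (Quotient.lift f hf)).subset ?_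
  rintro _ ⟨e, -, rfl⟩
  exact ⟨Quotient.mk _ e, rfl⟩

theorem IsPeriodic.finite_src_eq (hΓ : Γ.IsPeriodic L n) (x : V) : {e | Γ.src e = x}.Finite := by
  have := hΓ.finite_edges
  refine Set.Finite.of_injOn (f := Quotient.mk (AddAction.orbitRel L E)) (t := univ)
    (fun _ _ => mem_univ _) ?_ finite_univ
  intro e he e' he' h
  obtain ⟨u, rfl⟩ := AddAction.orbitRel_apply.1 (Quotient.exact h)
  have h1 : Γ.src (u +ᵥ e') = x := he
  have h2 : Γ.src e' = x := he'
  rw [hΓ.src_vadd, h2] at h1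
  simp [hΓ.free_vertices _ _ h1]

/-- Path lifting: each edge is translated so that its source is the vertex reached so far. -/
theorem IsPeriodic.exists_isWalk_of_labelPath (hΓ : Γ.IsPeriodic L n) {a b : Q} {g : ℕ × L}
    (hp : LabelPath (Γ.edgeLabels κ) univ a b g) (u : L) :
    ∃ p, Γ.IsWalk (u +ᵥ κ.rep a) p ((u + g.2) +ᵥ κ.rep b) ∧ Γ.walkWeight p = g.1 := by
  have key : ∀ (e : E) (u : L),
      Γ.src ((u - κ.trans (Γ.src e)) +ᵥ e) = u +ᵥ κ.rep (κ.cls (Γ.src e)) ∧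
      Γ.tgt ((u - κ.trans (Γ.src e)) +ᵥ e) =
        (u + (κ.trans (Γ.tgt e) - κ.trans (Γ.src e))) +ᵥ κ.rep (κ.cls (Γ.tgt e)) := by
    intro e u
    rw [hΓ.src_vadd, hΓ.tgt_vadd]
    constructor
    · conv_lhs => rw [← κ.vadd_rep (Γ.src e), vadd_vadd, κ.trans_vadd_rep, sub_add_cancel]
    · conv_lhs => rw [← κ.vadd_rep (Γ.tgt e), vadd_vadd]
      congr 1
      abel
  induction hp generalizing u with
  | single h =>
    obtain ⟨e, ⟨rfl, rfl⟩, rfl⟩ := h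
    refine ⟨[(u - κ.trans (Γ.src e)) +ᵥ e], ⟨(key e u).1, (key e u).2⟩, ?_⟩
    simp [walkWeight, hΓ.weight_vadd]
  | @cons a c b g h hg _ _ ih =>
    obtain ⟨e, ⟨rfl, rfl⟩, rfl⟩ := hg
    obtain ⟨p, hp, hw⟩ := ih (u + (κ.trans (Γ.tgt e) - κ.trans (Γ.src e)))
    refine ⟨((u - κ.trans (Γ.src e)) +ᵥ e) :: p, ⟨(key e u).1, ?_⟩, ?_⟩
    · rw [(key e u).2]
      simpa [add_assoc] using hp
    · simp [walkWeight, hΓ.weight_vadd] at hw ⊢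
      exact hw

/-- The growth region of an orbit of vertices is semilinear. -/
theorem IsPeriodic.isSemilinearSet_dist_le (hΓ : Γ.IsPeriodic L n) [Finite Q] (x₀ : V)
    (a : Q) :
    IsSemilinearSet {g : ℕ × L | Γ.dist x₀ (g.2 +ᵥ κ.rep a) ≤ g.1} := by
  classical
  have h1 : IsSemilinearSet {g | LabelPath (Γ.edgeLabels κ) univ (κ.cls x₀) a g} :=
    LabelPath.isSemilinearSet (fun b c => .of_finite (hΓ.finite_edgeLabels κ b c)) _ _ _
  -- The trivial walk, which `LabelPath` excludes; it matters only for the orbit of `x₀`.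
  have h2 : IsSemilinearSet {g : ℕ × L | g = 0 ∧ κ.cls x₀ = a} :=
    .of_finite ((finite_singleton 0).subset fun g hg => hg.1)
  -- The translation accounts for the position of `x₀` in its orbit; multiples of `(1, 0)` are the
  -- slack between the weight of a walk and the bound.
  have h3 := ((h1.union h2).vadd (0, κ.trans x₀)).add
    (IsSemilinearSet.closure_of_finite (finite_singleton ((1, 0) : ℕ × L)))
  convert h3
  ext ⟨i, u⟩
  simp only [mem_ofPred_eq, dist_le_iff, mem_add, mem_vadd_set, mem_union, SetLike.mem_coe,
    AddSubmonoid.mem_closure_singleton]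
  constructor
  · rintro ⟨p, hp, hw⟩
    refine ⟨_, ⟨(Γ.walkWeight p, u - κ.trans x₀), ?_, rfl⟩, _, ⟨i - Γ.walkWeight p, rfl⟩, ?_⟩
    · by_cases h : p = []
      · subst h
        obtain rfl : x₀ = _ := hp
        right
        simp [walkWeight, κ.trans_vadd_rep, κ.cls_vadd_rep]
      · left
        simpa [κ.trans_vadd_rep, κ.cls_vadd_rep] using hp.labelPath κ h
    · simp [hw]
  · rintro ⟨_, ⟨⟨j, v⟩, h, rfl⟩, _, ⟨k, rfl⟩, h'⟩
    simp only [vadd_eq_add, Prod.mk_add_mk, zero_add, Prod.smul_mk, smul_eq_mul, mul_one,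
      smul_zero, add_zero, Prod.mk.injEq] at h'
    obtain ⟨rfl, rfl⟩ := h'
    rcases h with h | ⟨h, rfl⟩
    · obtain ⟨p, hp, hw⟩ := hΓ.exists_isWalk_of_labelPath κ h (κ.trans x₀)
      rw [κ.vadd_rep] at hp
      exact ⟨p, hp, by omega⟩
    · obtain ⟨rfl, rfl⟩ := Prod.mk.injEq _ _ _ _ ▸ h
      refine ⟨[], ?_, by simp [walkWeight]⟩
      change x₀ = _
      rw [add_zero, κ.vadd_rep]

end WeightedDigraph

/-! ### Assembling the growth function -/

theorem SubAddAction.mem_closure_iff_exists_vadd {L V : Type*} [AddMonoid L] [AddAction L V]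
    {F : Set V} {y : V} : y ∈ SubAddAction.closure L F ↔ ∃ u : L, ∃ x ∈ F, u +ᵥ x = y := by
  constructor
  · intro h
    let P : SubAddAction L V :=
      { carrier := {y | ∃ u : L, ∃ x ∈ F, u +ᵥ x = y}
        vadd_mem' := by
          rintro c _ ⟨u, x, hx, rfl⟩
          exact ⟨c + u, x, hx, add_vadd c u x⟩ }
    exact SubAddAction.mem_closure.1 h P fun x hx => ⟨0, x, hx, zero_vadd L x⟩
  · rintro ⟨u, x, hx, rfl⟩
    exact SubAddAction.vadd_mem _ u (SubAddAction.mem_closure_of_mem hx)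

namespace WeightedDigraph

theorem IsPeriodic.isAddTorsionFree {V E L : Type*} [AddCommGroup L] [AddAction L V] [AddAction L E]
    {Γ : WeightedDigraph V E} {n : ℕ} (hΓ : Γ.IsPeriodic L n) : IsAddTorsionFree L := by
  obtain ⟨e⟩ := hΓ.lattice
  exact e.injective.isAddTorsionFree e.toAddMonoidHom

theorem IsPeriodic.fg_addSubgroup {V E L : Type*} [AddCommGroup L] [AddAction L V] [AddAction L E]
    {Γ : WeightedDigraph V E} {n : ℕ} (hΓ : Γ.IsPeriodic L n) (L' : AddSubgroup L) : L'.FG := by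
  obtain ⟨e⟩ := hΓ.lattice
  have : IsNoetherian ℤ L := isNoetherian_of_linearEquiv e.toIntLinearEquiv.symm
  have h := IsNoetherian.noetherian (AddSubgroup.toIntSubmodule L')
  rwa [Submodule.fg_iff_addSubgroup_fg] at h

/-- The weight of a pair is the bound `i`, not the distance, so its fibres are the cumulative sets
of the theorem and no summation over distances is needed. -/
theorem IsPeriodic.hasQuasiPolyCount {V E L : Type*} [AddCommGroup L] [AddAction L V]
    [AddAction L E] {Γ : WeightedDigraph V E} {n : ℕ} (hΓ : Γ.IsPeriodic L n) (x₀ : V)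
    (L' : AddSubgroup L) (V' : SubAddAction L' V) (hV' : V'.FG) :
    HasQuasiPolyCount Prod.fst {g : ℕ × V | g.2 ∈ V' ∧ Γ.dist x₀ g.2 ≤ g.1} := by
  obtain ⟨κ⟩ := OrbitCoordinates.nonempty_of_free hΓ.free_vertices
  obtain ⟨F, hF, rfl⟩ := hV'
  have := hΓ.finite_vertices
  have := hΓ.isAddTorsionFree
  have hL : AddMonoid.FG L := AddGroup.fg_iff_addMonoid_fg.1
    (AddGroup.fg_def.2 (hΓ.fg_addSubgroup ⊤))
  have := Fintype.ofFinite (AddAction.orbitRel.Quotient L V)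
  let A : AddAction.orbitRel.Quotient L V → Set (ℕ × L) := fun a =>
    {g | g.2 +ᵥ κ.rep a ∈ SubAddAction.closure L' F ∧ Γ.dist x₀ (g.2 +ᵥ κ.rep a) ≤ g.1}
  have hsemi : ∀ a, IsSemilinearSet (A a) := by
    intro a
    have h1 : IsSemilinearSet {u : L | u +ᵥ κ.rep a ∈ SubAddAction.closure L' F} := by
      -- Within one orbit, `V'` is a finite union of cosets of `L'`, one for each generator in that
      -- orbit.
      have h2 : {u : L | u +ᵥ κ.rep a ∈ SubAddAction.closure L' F} =
          ⋃ x ∈ {x ∈ F | κ.cls x = a}, κ.trans x +ᵥ (L'.toAddSubmonoid : Set L) := by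
        ext u
        simp only [mem_ofPred_eq, SubAddAction.mem_closure_iff_exists_vadd, mem_iUnion,
          mem_vadd_set]
        constructor
        · rintro ⟨v, x, hx, h⟩
          have h : (v : L) +ᵥ x = u +ᵥ κ.rep a := h
          refine ⟨x, ⟨hx, ?_⟩, v, v.2, ?_⟩
          · rw [← κ.cls_vadd v x, h, κ.cls_vadd_rep]
          · rw [vadd_eq_add, add_comm, ← κ.trans_vadd, h, κ.trans_vadd_rep]
        · rintro ⟨x, ⟨hx, rfl⟩, v, hv, rfl⟩
          refine ⟨⟨v, hv⟩, x, hx, ?_⟩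
          change v +ᵥ x = _
          rw [vadd_eq_add, add_comm, ← vadd_vadd, κ.vadd_rep]
      rw [h2]
      exact .biUnion (hF.subset fun x hx => hx.1) fun x _ => .vadd _ (.of_fg
        ((AddSubgroup.fg_iff_addSubmonoid_fg _).1 (hΓ.fg_addSubgroup L')))
    exact (h1.preimage (AddMonoidHom.snd ℕ L)).inter (hΓ.isSemilinearSet_dist_le κ x₀ a)
  have hinj : ∀ a, Function.Injective fun g : ℕ × L => (g.1, g.2 +ᵥ κ.rep a) := by
    rintro a ⟨i, u⟩ ⟨j, v⟩ h
    simp only [Prod.mk.injEq] at h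
    rw [Prod.mk.injEq]
    exact ⟨h.1, by simpa [κ.trans_vadd_rep] using congrArg κ.trans h.2⟩
  have hfin : ∀ a i, {g ∈ A a | AddMonoidHom.fst ℕ L g = i}.Finite := by
    intro a i
    refine Set.Finite.of_injOn (f := fun g : ℕ × L => (g.1, g.2 +ᵥ κ.rep a))
      (t := {i} ×ˢ {y | Γ.dist x₀ y ≤ i}) ?_ (hinj a).injOn
      ((finite_singleton i).prod (Γ.finite_setOf_dist_le hΓ.finite_src_eq x₀ i))
    rintro ⟨j, u⟩ ⟨h, rfl⟩
    exact ⟨rfl, h.2⟩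
  have hcount : ∀ a, HasQuasiPolyCount (Prod.fst : ℕ × V → ℕ)
      ((fun g : ℕ × L => (g.1, g.2 +ᵥ κ.rep a)) '' A a) := fun a =>
    ((hsemi a).hasQuasiPolyCount (hfin a)).image (a := 0) (hinj a).injOn fun _ _ => rfl
  convert HasQuasiPolyCount.biUnion_disjoint Finset.univ _ (fun a _ => hcount a) ?_
  · ext ⟨i, y⟩
    simp only [Finset.mem_univ, iUnion_true, mem_iUnion, mem_image, mem_ofPred_eq]
    constructor
    · intro h
      refine ⟨κ.cls y, (i, κ.trans y), ?_, ?_⟩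
      · simpa only [A, mem_ofPred_eq, κ.vadd_rep] using h
      · rw [κ.vadd_rep]
    · rintro ⟨a, ⟨j, u⟩, h, h'⟩
      rw [Prod.mk.injEq] at h'
      obtain ⟨rfl, rfl⟩ := h'
      exact h
  · intro a b hab
    rw [Set.disjoint_left]
    rintro _ ⟨g, -, rfl⟩ ⟨g', -, h⟩
    refine hab ?_
    simpa [κ.cls_vadd_rep] using (congrArg (fun g : ℕ × V => κ.cls g.2) h).symm

end WeightedDigraph

theorem theoremA4 {V E L : Type*} [AddCommGroup L] [AddAction L V] [AddAction L E]
    (Γ : WeightedDigraph V E) (n : ℕ) (hΓ : Γ.IsPeriodic L n) (x₀ : V)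
    (L' : AddSubgroup L) (V' : SubAddAction L' V) (hV' : V'.FG) :
    (∀ i : ℕ, {y : V | y ∈ V' ∧ Γ.dist x₀ y ≤ (i : ℕ∞)}.Finite) ∧
      IsOfQuasiPolynomialType
        (fun i : ℕ => (Set.ncard {y : V | y ∈ V' ∧ Γ.dist x₀ y ≤ (i : ℕ∞)} : ℂ)) := by
  refine ⟨fun i => (Γ.finite_setOf_dist_le hΓ.finite_src_eq x₀ i).subset fun y hy => hy.2, ?_⟩
  refine ((hΓ.hasQuasiPolyCount x₀ L' V' hV').count.congr 0
    fun i _ => ?_).isOfQuasiPolynomialType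
  have h : {g ∈ {g : ℕ × V | g.2 ∈ V' ∧ Γ.dist x₀ g.2 ≤ g.1} | g.1 = i} =
      (fun y => (i, y)) '' {y : V | y ∈ V' ∧ Γ.dist x₀ y ≤ (i : ℕ∞)} := by
    ext ⟨j, y⟩
    simp only [mem_ofPred_eq, mem_image, Prod.mk.injEq]
    constructor
    · rintro ⟨h, rfl⟩
      exact ⟨y, h, rfl, rfl⟩
    · rintro ⟨z, h, rfl, rfl⟩
      exact ⟨h, rfl⟩
  rw [h, (Prod.mk_right_injective i).injOn.ncard_image]
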